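/- Let $\mathcal P$ be the set of Borel probability measures on $\mathbf R_+=[0,\infty)$ with the topology of weak convergence; for $a\ge 0$ let $T_a\mu$ be the law of $aX$ when $X$ has law $\mu$. A \emph{generalised convolution} (Urbanik) is a commutative, associative binary operation $\cdot$ on $\mathcal P$ such that $\delta_0\cdot\mu=\mu$; $(a\mu+b\nu)\cdot\rho=a(\mu\cdot\rho)+b(\nu\cdot\rho)$ for $a,b\ge 0$, $a+b=1$; $T_a\mu\cdot T_a\nu=T_a(\mu\cdot\nu)$ for $a>0$; $\mu\mapsto\mu\cdot\nu$ is weakly continuous for every $\nu$; and there are $c_n>0$ such that $T_{c_n}\delta_1^{\cdot n}$ converges weakly to a measure $\sigma\ne\delta_0$ (any such limit is called a characteristic measure). A \emph{characteristic function} for $\cdot$ is an injective map $\mu\mapsto\Phi_\mu$ from $\mathcal P$ to the real functions on $\mathbf R_+$ with $\Phi_{a\mu+b\nu}=a\Phi_\mu+b\Phi_\nu$ ($a,b\ge0$, $a+b=1$), $\Phi_{\mu\cdot\nu}=\Phi_\mu\Phi_\nu$, $\Phi_{T_a\mu}(t)=\Phi_\mu(at)$ ($a>0$), and such that $\mu_j\to\mu$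 weakly if and only if $\Phi_{\mu_j}\to\Phi_\mu$ uniformly on every bounded interval. A number $\kappa>0$ is a \emph{characteristic index} of $\cdot$ if $\Phi_\sigma(t)=e^{-t^\kappa}$ ($t\ge0$) for some characteristic measure $\sigma$ and some characteristic function $\Phi$. Write $\mu_n=\int x^n\,d\mu(x)$, and $\mu^{\cdot k}$ for the composition of $k$ copies of $\mu$. Call $\cdot$ \emph{multinomial} if, for every $\mu\in\mathcal P$ with all moments finite and every $k\ge1$, all moments of $\mu^{\cdot k}$ are finite and $$(\mu^{\cdot k})_n=\sum_{n_1+\cdots+n_k=n}\frac{n!}{n_1!\cdots n_k!}\,\mu_{n_1}\cdots\mu_{n_k}\qquad(n\ge0),$$ the sum being over non-negative integers $n_1,\dots,n_k$. \textbf{Proposition.} The classical convolution on $\mathcal P$ is a generalised convolution, it is multinomial, and $1$ is its one and only characteristic index. No generalised convolution other than the classical convolution is multinomial. -/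

import Mathlib

open MeasureTheory Filter Topology
open scoped NNReal

noncomputable section

namespace GenConv

/-- Borel probability measures on `[0, ∞)`; the topology is that of weak convergence. -/
abbrev P : Type := ProbabilityMeasure ℝ≥0

/-- The unit mass at `x`. -/
abbrev delta (x : ℝ≥0) : P := diracProba x

/-- The convex combination `a μ + b ν` with `a + b = 1`. -/
def mix (a b : ℝ≥0) (hab : a + b = 1) (μ ν : P) : P :=
  ⟨a • (μ : Measure ℝ≥0) + b • (ν : Measure ℝ≥0), ⟨by
    simp only [Measure.add_apply, Measure.smul_apply, measure_univ]
    rw [ENNReal.smul_def, ENNReal.smul_def, smul_eq_mul, smul_eq_mul, mul_one, mul_one]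
    exact_mod_cast hab⟩⟩

/-- The change of scale `T_a μ`, that is, the law of `a X` when `X` has law `μ`. -/
def scale (a : ℝ≥0) (μ : P) : P :=
  μ.map (f := fun x : ℝ≥0 => a * x) (measurable_const_mul a).aemeasurable

/-- The composition of `k` copies of `μ` under the operation `op`. -/
def power (op : P → P → P) (μ : P) : ℕ → P
  | 0 => delta 0
  | k + 1 => op (power op μ k) μ

/-- `σ` is a characteristic measure of `op`: it is not `δ₀`, and it is the weak limit of suitable
rescalings of the powers of `δ₁`. -/
def IsCharacteristicMeasure (op : P → P → P) (σ : P) : Prop :=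
  σ ≠ delta 0 ∧ ∃ c : ℕ → ℝ≥0, (∀ n, 0 < c n) ∧
    Tendsto (fun n => scale (c n) (power op (delta 1) n)) atTop (𝓝 σ)

/-- Urbanik's generalised convolutions. -/
structure IsGeneralizedConvolution (op : P → P → P) : Prop where
  comm : ∀ μ ν, op μ ν = op ν μ
  assoc : ∀ μ ν ρ, op (op μ ν) ρ = op μ (op ν ρ)
  unit : ∀ μ, op (delta 0) μ = μ
  distrib : ∀ (a b : ℝ≥0) (hab : a + b = 1) (μ ν ρ : P),
    op (mix a b hab μ ν) ρ = mix a b hab (op μ ρ) (op ν ρ)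
  homogeneous : ∀ (a : ℝ≥0), 0 < a → ∀ μ ν, op (scale a μ) (scale a ν) = scale a (op μ ν)
  continuous : ∀ ν, Continuous fun μ => op μ ν
  exists_characteristicMeasure : ∃ σ, IsCharacteristicMeasure op σ

/-- `Φ` is a (generalised) characteristic function for `op`: an injective assignment
`μ ↦ Φ μ` of real functions on `[0, ∞)` which respects convex combinations and changes of scale,
takes `op` to the pointwise product, and under which weak convergence corresponds to uniform
convergence on bounded intervals. -/
structure IsCharacteristicFunction (op : P → P → P) (Φ : P → ℝ≥0 → ℝ) : Prop where
  injective : Function.Injective Φ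
  map_mix : ∀ (a b : ℝ≥0) (hab : a + b = 1) (μ ν : P) (t : ℝ≥0),
    Φ (mix a b hab μ ν) t = a * Φ μ t + b * Φ ν t
  map_op : ∀ (μ ν : P) (t : ℝ≥0), Φ (op μ ν) t = Φ μ t * Φ ν t
  map_scale : ∀ (a : ℝ≥0), 0 < a → ∀ (μ : P) (t : ℝ≥0), Φ (scale a μ) t = Φ μ (a * t)
  tendsto_iff : ∀ (μs : ℕ → P) (μ : P), Tendsto μs atTop (𝓝 μ) ↔
    ∀ R : ℝ≥0, TendstoUniformlyOn (fun n => Φ (μs n)) (Φ μ) atTop (Set.Icc 0 R)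

/-- `κ > 0` is a characteristic index of `op`: for some characteristic measure `σ`
and some characteristic function, that of `σ` is `t ↦ exp (-t ^ κ)`. -/
def IsCharacteristicIndex (op : P → P → P) (κ : ℝ) : Prop :=
  0 < κ ∧ ∃ σ, IsCharacteristicMeasure op σ ∧ ∃ Φ, IsCharacteristicFunction op Φ ∧
    ∀ t : ℝ≥0, Φ σ t = Real.exp (-((t : ℝ) ^ κ))

/-- All moments of `μ` are finite. -/
def HasMoments (μ : P) : Prop :=
  ∀ n : ℕ, Integrable (fun x : ℝ≥0 => (x : ℝ) ^ n) (μ : Measure ℝ≥0)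

/-- The `n`-th moment of `μ`. -/
def moment (μ : P) (n : ℕ) : ℝ := ∫ x : ℝ≥0, (x : ℝ) ^ n ∂(μ : Measure ℝ≥0)

/-- `op` is multinomial: the composition of `k` copies of a measure `μ` with finite moments
has finite moments, the `n`-th being the sum over all `(n₁, …, n_k)` with `n₁ + ⋯ + n_k = n` of
`n! / (n₁! ⋯ n_k!)` times the product of the `n_i`-th moments of `μ`. -/
def IsMultinomial (op : P → P → P) : Prop :=
  ∀ μ : P, HasMoments μ → ∀ k : ℕ, 1 ≤ k →
    HasMoments (power op μ k) ∧
    ∀ n : ℕ, moment (power op μ k) n =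
      ∑ m ∈ Finset.piAntidiag (Finset.univ : Finset (Fin k)) n,
        ((n.factorial : ℝ) / ∏ i, ((m i).factorial : ℝ)) * ∏ i, moment μ (m i)

/-- The classical convolution: the law of the sum of independent variables. -/
def classical (μ ν : P) : P :=
  ⟨(μ : Measure ℝ≥0).conv (ν : Measure ℝ≥0), inferInstance⟩

end GenConv

end

/-! The Laplace transform turns the classical convolution into a product, and the continuity theorem
(`tendsto_iff_laplace`) makes it a characteristic function. Since `δ₁` is a characteristic measure
with transform `exp (-t)`, the number 1 is an index. For any other choice of `Φ` and `σ`, the powers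
of `δ₁` are the `δₙ`, so `Φ σ (2t) = (Φ σ t)²`, which forces `2 ^ κ = 2`.

The multinomial formula is the coefficient identity for powers of the exponential generating
function of the moments.

For uniqueness only `k = 2` is needed. If `μ` is bounded, the moments of its classical square grow
at most geometrically, so they determine it and both operations have the same square at `μ`.
Polarisation, using bilinearity on mixtures, gives equality on pairs of bounded measures; truncation
and separate continuity give it everywhere. -/

namespace GenConv

/-! ### Laplace transform -/

open BoundedContinuousFunction in
/-- The function `x ↦ exp (-t x)` on `[0, ∞)`. -/
noncomputable def expNeg (t : ℝ≥0) : ℝ≥0 →ᵇ ℝ :=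
  ofNormedAddCommGroup (fun x : ℝ≥0 => Real.exp (-((t : ℝ) * x))) (by fun_prop) 1 fun x => by
    rw [Real.norm_eq_abs, abs_of_pos (Real.exp_pos _), Real.exp_le_one_iff]
    exact neg_nonpos.2 (by positivity)

@[simp] lemma expNeg_apply (t x : ℝ≥0) : expNeg t x = Real.exp (-((t : ℝ) * x)) := rfl

lemma expNeg_le_one (t x : ℝ≥0) : expNeg t x ≤ 1 := by
  rw [expNeg_apply, Real.exp_le_one_iff]
  exact neg_nonpos.2 (by positivity)

lemma expNeg_add (s t : ℝ≥0) : expNeg (s + t) = expNeg s * expNeg t := by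
  ext x
  simp only [expNeg_apply, BoundedContinuousFunction.mul_apply, ← Real.exp_add, NNReal.coe_add]
  ring_nf

lemma expNeg_one_pow (n : ℕ) : expNeg 1 ^ n = expNeg n := by
  induction n with
  | zero => ext x; simp
  | succ n ih => rw [pow_succ, ih, Nat.cast_succ, expNeg_add]

/-- The Laplace transform of `μ`. -/
noncomputable def laplace (μ : P) (t : ℝ≥0) : ℝ := ∫ x, expNeg t x ∂(μ : Measure ℝ≥0)

lemma integrable_expNeg (μ : P) (t : ℝ≥0) : Integrable (expNeg t) (μ : Measure ℝ≥0) :=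
  BoundedContinuousFunction.integrable _ _

lemma laplace_zero (μ : P) : laplace μ 0 = 1 := by simp [laplace]

lemma laplace_antitone (μ : P) : Antitone (laplace μ) := by
  intro s t h
  refine integral_mono (integrable_expNeg μ t) (integrable_expNeg μ s) fun x => ?_
  simp only [expNeg_apply]
  gcongr

/-- Since `e^{-sx} (1 - e^{-δx}) ≤ 1 - e^{-δx}`, the modulus of continuity at any point is
controlled by the one at 0. This is the source of equicontinuity below. -/
lemma laplace_sub_le (μ : P) {s t δ : ℝ≥0} (hδ : t ≤ s + δ) :
    laplace μ s - laplace μ t ≤ 1 - laplace μ δ := by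
  have h1 : laplace μ (s + δ) ≤ laplace μ t := laplace_antitone μ hδ
  have h2 : laplace μ s - laplace μ (s + δ) ≤ 1 - laplace μ δ := by
    rw [← laplace_zero μ]
    simp only [laplace]
    rw [← integral_sub (integrable_expNeg _ _) (integrable_expNeg _ _),
      ← integral_sub (integrable_expNeg _ _) (integrable_expNeg _ _)]
    refine integral_mono ((integrable_expNeg _ _).sub (integrable_expNeg _ _))
      ((integrable_expNeg _ _).sub (integrable_expNeg _ _)) fun x => ?_
    have h0 : expNeg 0 x = 1 := by simp
    have := expNeg_le_one δ x
    have := expNeg_le_one s x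
    simp only [expNeg_add, BoundedContinuousFunction.mul_apply, h0]
    nlinarith
  linarith

lemma abs_laplace_sub_le (μ : P) {s t δ : ℝ≥0} (h : dist s t ≤ δ) :
    |laplace μ s - laplace μ t| ≤ 1 - laplace μ δ := by
  rw [NNReal.dist_eq, abs_le] at h
  rcases le_total s t with hst | hst
  · rw [abs_of_nonneg (sub_nonneg.2 (laplace_antitone μ hst))]
    exact laplace_sub_le μ (by rw [← NNReal.coe_le_coe, NNReal.coe_add]; linarith)
  · rw [abs_sub_comm, abs_of_nonneg (sub_nonneg.2 (laplace_antitone μ hst))]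
    exact laplace_sub_le μ (by rw [← NNReal.coe_le_coe, NNReal.coe_add]; linarith)

lemma continuous_laplace (μ : P) : Continuous (laplace μ) := by
  refine continuous_of_dominated (bound := fun _ => 1)
    (fun t => (expNeg t).continuous.aestronglyMeasurable) (fun t => .of_forall fun x => ?_)
    (integrable_const _) (.of_forall fun x => ?_)
  · rw [Real.norm_eq_abs, expNeg_apply, abs_of_pos (Real.exp_pos _)]
    exact expNeg_le_one t x
  · simp only [expNeg_apply]
    fun_prop

lemma laplace_eq_integral_pow (μ : P) (n : ℕ) :
    laplace μ n = ∫ x, (expNeg 1 ^ n) x ∂(μ : Measure ℝ≥0) := by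
  rw [expNeg_one_pow, laplace]

/-! ### Continuity theorem for the Laplace transform -/

/-- The algebra generated by `x ↦ exp (-x)`. -/
noncomputable def expAlgebra : StarSubalgebra ℝ (BoundedContinuousFunction ℝ≥0 ℝ) :=
  StarAlgebra.adjoin ℝ {expNeg 1}

lemma separatesPoints_expAlgebra :
    (expAlgebra.map (BoundedContinuousFunction.toContinuousMapStarₐ ℝ)).SeparatesPoints := by
  intro x y hxy
  refine ⟨_, ⟨_, ⟨expNeg 1, StarAlgebra.self_mem_adjoin_singleton _ _, rfl⟩, rfl⟩, ?_⟩
  simpa using hxy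

/-- The generator is self-adjoint, so the algebra is spanned by its powers, whose integrals are
Laplace transforms at integers. -/
lemma mem_expAlgebra {g : BoundedContinuousFunction ℝ≥0 ℝ} (hg : g ∈ expAlgebra) :
    g ∈ Submodule.span ℝ (Set.range fun n : ℕ => expNeg 1 ^ n) := by
  have h : g ∈ Subalgebra.toSubmodule (StarAlgebra.adjoin ℝ {expNeg 1}).toSubalgebra := hg
  rw [StarAlgebra.adjoin_eq_span] at h
  refine Submodule.span_mono ?_ h
  have hs : star (expNeg 1) = expNeg 1 := by ext x; simp
  rw [Set.star_singleton, hs, Set.union_self, ← Submonoid.powers_eq_closure]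
  rintro _ ⟨n, rfl⟩
  exact ⟨n, rfl⟩

lemma tendsto_integral_of_mem_expAlgebra {ι : Type*} {l : Filter ι} {μs : ι → P} {μ : P}
    (h : ∀ t, Tendsto (fun i => laplace (μs i) t) l (𝓝 (laplace μ t)))
    {g : BoundedContinuousFunction ℝ≥0 ℝ} (hg : g ∈ expAlgebra) :
    Tendsto (fun i => ∫ x, g x ∂(μs i : Measure ℝ≥0)) l (𝓝 (∫ x, g x ∂(μ : Measure ℝ≥0))) := by
  refine Submodule.span_induction (p := fun g _ => Tendsto
    (fun i => ∫ x, g x ∂(μs i : Measure ℝ≥0)) l (𝓝 (∫ x, g x ∂(μ : Measure ℝ≥0))))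
    ?_ ?_ ?_ ?_ (mem_expAlgebra hg)
  · rintro _ ⟨n, rfl⟩
    simpa only [laplace_eq_integral_pow] using h n
  · simpa using tendsto_const_nhds
  · intro f g _ _ hf hg
    have (ν : P) : ∫ x, (f + g) x ∂(ν : Measure ℝ≥0) = ∫ x, f x ∂(ν : Measure ℝ≥0) +
        ∫ x, g x ∂(ν : Measure ℝ≥0) :=
      integral_add (f.integrable _) (g.integrable _)
    simp only [this]
    exact hf.add hg
  · intro a f _ hf
    have (ν : P) : ∫ x, (a • f) x ∂(ν : Measure ℝ≥0) = a * ∫ x, f x ∂(ν : Measure ℝ≥0) :=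
      integral_const_mul a _
    simp only [this]
    exact hf.const_mul a

/-- For `x > δ⁻¹` one has `e^{δx} ≥ 1 + δx > 2`, hence `2 (1 - e^{-δx}) ≥ 1`. -/
lemma measureReal_Icc_compl_le (μ : P) {δ : ℝ≥0} (hδ : 0 < δ) :
    (μ : Measure ℝ≥0).real (Set.Icc 0 δ⁻¹)ᶜ ≤ 2 * (1 - laplace μ δ) := by
  have hint : Integrable (fun x => 2 * (1 - expNeg δ x)) (μ : Measure ℝ≥0) :=
    ((integrable_const _).sub (integrable_expNeg μ δ)).const_mul 2
  have h1 : 2 * (1 - laplace μ δ) = ∫ x, 2 * (1 - expNeg δ x) ∂(μ : Measure ℝ≥0) := by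
    rw [integral_const_mul, integral_sub (integrable_const _) (integrable_expNeg μ δ)]
    simp [laplace]
  have hm : MeasurableSet (Set.Icc 0 δ⁻¹)ᶜ := measurableSet_Icc.compl
  rw [h1, ← integral_indicator_one hm]
  refine integral_mono ((integrable_const _).indicator hm) hint fun x => ?_
  have := expNeg_le_one δ x
  by_cases hx : x ∈ (Set.Icc 0 δ⁻¹)ᶜ
  · rw [Set.indicator_of_mem hx]
    have hx' : δ⁻¹ < x := by simpa using hx
    have h3 : (1 : ℝ) < δ * x := by
      rw [inv_lt_iff_one_lt_mul₀ hδ] at hx'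
      rw [mul_comm]
      exact_mod_cast hx'
    have h4 : expNeg δ x ≤ 1 / 2 := by
      rw [expNeg_apply, Real.exp_neg, one_div]
      refine inv_anti₀ two_pos ?_
      linarith [Real.add_one_le_exp ((δ : ℝ) * x)]
    simp only [Pi.one_apply]
    linarith
  · rw [Set.indicator_of_notMem hx]
    linarith

lemma exists_one_sub_laplace_lt (μ : P) {ε : ℝ} (hε : 0 < ε) :
    ∃ δ, 0 < δ ∧ 1 - laplace μ δ < ε := by
  have h := (continuous_laplace μ).tendsto 0
  rw [laplace_zero] at h
  have h2 : ∀ᶠ t in 𝓝[>] 0, 1 - ε < laplace μ t :=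
    (h.mono_left nhdsWithin_le_nhds).eventually_const_lt (by linarith)
  obtain ⟨δ, h3, h4⟩ := (h2.and self_mem_nhdsWithin).exists
  exact ⟨δ, h4, by linarith⟩

lemma isTightMeasureSet_of_tendsto_laplace {μs : ℕ → P} {μ : P}
    (h : ∀ t, Tendsto (fun i => laplace (μs i) t) atTop (𝓝 (laplace μ t))) :
    IsTightMeasureSet {(μs n : Measure ℝ≥0) | n} := by
  rw [isTightMeasureSet_iff_exists_isCompact_measure_compl_le]
  intro ε' hε'
  obtain ⟨ε, hε, hεε'⟩ : ∃ ε : ℝ, 0 < ε ∧ ENNReal.ofReal (2 * ε) ≤ ε' := by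
    obtain ⟨r, hr, hr'⟩ := ENNReal.lt_iff_exists_nnreal_btwn.1 hε'
    refine ⟨r / 2, by have : 0 < r := by exact_mod_cast hr
                      positivity, ?_⟩
    rw [mul_div_cancel₀ _ two_ne_zero, ENNReal.ofReal_coe_nnreal]
    exact hr'.le
  obtain ⟨δ₀, hδ₀, hμ⟩ := exists_one_sub_laplace_lt μ hε
  obtain ⟨N, hN⟩ := eventually_atTop.1 ((h δ₀).eventually_const_lt (u := 1 - ε) (by linarith))
  choose d hd hd' using fun n => exists_one_sub_laplace_lt (μs n) hε
  obtain ⟨δ, hδ, hall⟩ : ∃ δ, 0 < δ ∧ ∀ n, 1 - laplace (μs n) δ ≤ ε := by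
    -- `δ₀` serves all `n ≥ N`; the finitely many other measures each have their own `d n`, so the
    -- minimum serves all.
    refine ⟨(Finset.range (N + 1)).inf' (by simp) d ⊓ δ₀, ?_, fun n => ?_⟩
    · simp [hδ₀, hd]
    · rcases le_total N n with hn | hn
      · have := laplace_antitone (μs n)
          (inf_le_right : (Finset.range (N + 1)).inf' (by simp) d ⊓ δ₀ ≤ δ₀)
        linarith [hN n hn]
      · have := laplace_antitone (μs n) ((inf_le_left.trans (Finset.inf'_le d
          (Finset.mem_range.2 (Nat.lt_succ_of_le hn)))) :
            (Finset.range (N + 1)).inf' (by simp) d ⊓ δ₀ ≤ d n)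
        linarith [hd' n]
  refine ⟨Set.Icc 0 δ⁻¹, isCompact_Icc, ?_⟩
  rintro _ ⟨n, rfl⟩
  refine le_trans ?_ hεε'
  rw [← ofReal_measureReal]
  refine ENNReal.ofReal_le_ofReal ((measureReal_Icc_compl_le (μs n) hδ).trans ?_)
  linarith [hall n]

lemma tendsto_of_tendsto_laplace {μs : ℕ → P} {μ : P}
    (h : ∀ t, Tendsto (fun i => laplace (μs i) t) atTop (𝓝 (laplace μ t))) :
    Tendsto μs atTop (𝓝 μ) :=
  ProbabilityMeasure.tendsto_of_tight_of_separatesPoints ℝ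
    (isTightMeasureSet_of_tendsto_laplace h) separatesPoints_expAlgebra
    fun _ => tendsto_integral_of_mem_expAlgebra h

lemma tendsto_laplace {ι : Type*} {l : Filter ι} {μs : ι → P} {μ : P}
    (h : Tendsto μs l (𝓝 μ)) (t : ℝ≥0) :
    Tendsto (fun i => laplace (μs i) t) l (𝓝 (laplace μ t)) :=
  ProbabilityMeasure.tendsto_iff_forall_integral_tendsto.1 h (expNeg t)

/-- Convergence at the single point `δ` bounds the oscillation of almost all the transforms on every
ball of radius `δ`. -/
lemma tendstoLocallyUniformly_laplace {μs : ℕ → P} {μ : P}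
    (h : ∀ t, Tendsto (fun i => laplace (μs i) t) atTop (𝓝 (laplace μ t))) :
    TendstoLocallyUniformly (fun n => laplace (μs n)) (laplace μ) atTop := by
  rw [Metric.tendstoLocallyUniformly_iff]
  intro ε hε t
  obtain ⟨δ, hδ, hμ⟩ := exists_one_sub_laplace_lt μ (show 0 < ε / 3 by positivity)
  refine ⟨Metric.closedBall t δ, Metric.closedBall_mem_nhds _ hδ, ?_⟩
  filter_upwards [(h δ).eventually_const_lt (u := 1 - ε / 3) (by linarith),
    Metric.tendsto_nhds.1 (h t) (ε / 3) (by positivity)] with n h1 h2 s hs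
  have h3 := abs_laplace_sub_le μ (Metric.mem_closedBall.1 hs)
  have h4 := abs_laplace_sub_le (μs n) (Metric.mem_closedBall.1 hs)
  rw [Real.dist_eq] at h2 ⊢
  rw [abs_lt] at h2 ⊢
  rw [abs_le] at h3 h4
  constructor <;> linarith

lemma laplace_injective : Function.Injective laplace := by
  intro μ ν h
  have : Tendsto (fun _ : ℕ => μ) atTop (𝓝 ν) :=
    tendsto_of_tendsto_laplace fun t => by rw [h]; exact tendsto_const_nhds
  exact tendsto_nhds_unique tendsto_const_nhds this

lemma tendsto_iff_laplace (μs : ℕ → P) (μ : P) : Tendsto μs atTop (𝓝 μ) ↔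
    ∀ R : ℝ≥0, TendstoUniformlyOn (fun n => laplace (μs n)) (laplace μ) atTop (Set.Icc 0 R) := by
  refine ⟨fun h R => ?_, fun h => tendsto_of_tendsto_laplace fun t =>
    (h t).tendsto_at (Set.right_mem_Icc.2 zero_le)⟩
  rw [← tendstoLocallyUniformlyOn_iff_tendstoUniformlyOn_of_compact isCompact_Icc]
  exact (tendstoLocallyUniformly_laplace (tendsto_laplace h)).tendstoLocallyUniformlyOn

/-! ### The classical convolution -/

@[simp] lemma coe_classical (μ ν : P) :
    (classical μ ν : Measure ℝ≥0) = (μ : Measure ℝ≥0).conv (ν : Measure ℝ≥0) := rfl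

lemma coe_mix (a b : ℝ≥0) (hab : a + b = 1) (μ ν : P) :
    (mix a b hab μ ν : Measure ℝ≥0) = a • (μ : Measure ℝ≥0) + b • (ν : Measure ℝ≥0) := rfl

lemma coe_scale (a : ℝ≥0) (μ : P) :
    (scale a μ : Measure ℝ≥0) = (μ : Measure ℝ≥0).map fun x => a * x := rfl

lemma coe_delta (x : ℝ≥0) : (delta x : Measure ℝ≥0) = Measure.dirac x := rfl

lemma scale_delta (a x : ℝ≥0) : scale a (delta x) = delta (a * x) :=
  Subtype.ext (Measure.map_dirac' (measurable_const_mul a) x)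

lemma classical_delta (x y : ℝ≥0) : classical (delta x) (delta y) = delta (x + y) :=
  Subtype.ext (Measure.dirac_conv_dirac x y)

lemma classical_comm (μ ν : P) : classical μ ν = classical ν μ :=
  Subtype.ext (Measure.conv_comm _ _)

lemma classical_delta_zero (μ : P) : classical (delta 0) μ = μ :=
  Subtype.ext (Measure.dirac_zero_conv _)

lemma power_classical_delta_one (n : ℕ) : power classical (delta 1) n = delta n := by
  induction n with
  | zero => simp [power]
  | succ n ih => rw [power, ih, classical_delta, Nat.cast_succ]

lemma continuous_classical (ν : P) : Continuous fun μ => classical μ ν := by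
  rw [ProbabilityMeasure.continuous_iff_forall_continuous_integral]
  intro f
  have hb (z : ℝ≥0) : ‖f z‖ ≤ ‖f‖ := f.norm_coe_le_norm z
  let g : BoundedContinuousFunction ℝ≥0 ℝ :=
    BoundedContinuousFunction.ofNormedAddCommGroup
      (fun x : ℝ≥0 => ∫ y, f (x + y) ∂(ν : Measure ℝ≥0))
      (continuous_of_dominated (bound := fun _ => ‖f‖)
        (fun x => (f.continuous.comp (continuous_const_add x)).aestronglyMeasurable)
        (fun x => .of_forall fun y => hb _) (integrable_const _)
        (.of_forall fun y => f.continuous.comp (continuous_add_const y)))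
      ‖f‖ fun x => by
        simpa using norm_integral_le_of_norm_le_const (μ := (ν : Measure ℝ≥0))
          (.of_forall fun y => hb (x + y))
  have (μ : P) : ∫ z, f z ∂(classical μ ν : Measure ℝ≥0) = ∫ x, g x ∂(μ : Measure ℝ≥0) :=
    integral_conv (f.integrable _)
  simp only [this]
  exact ProbabilityMeasure.continuous_integral_boundedContinuousFunction g

lemma isCharacteristicMeasure_classical_delta_one :
    IsCharacteristicMeasure classical (delta 1) := by
  refine ⟨fun h => one_ne_zero (injective_diracProba h),
    -- The value at 0 is separate because `0⁻¹ = 0` is not positive.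
    fun n => if n = 0 then 1 else (n : ℝ≥0)⁻¹, fun n => ?_, ?_⟩
  · dsimp only
    split_ifs with h
    · exact one_pos
    · exact inv_pos.2 (Nat.cast_pos.2 (Nat.pos_of_ne_zero h))
  · refine tendsto_const_nhds.congr' ?_
    filter_upwards [eventually_ne_atTop 0] with n hn
    rw [if_neg hn, power_classical_delta_one, scale_delta,
      inv_mul_cancel₀ (Nat.cast_ne_zero.2 hn)]

theorem isGeneralizedConvolution_classical : IsGeneralizedConvolution classical where
  comm := classical_comm
  assoc μ ν ρ := Subtype.ext (Measure.conv_assoc _ _ _)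
  unit := classical_delta_zero
  distrib a b hab μ ν ρ := by
    apply Subtype.ext
    change (a • (μ : Measure ℝ≥0) + b • (ν : Measure ℝ≥0)).conv (ρ : Measure ℝ≥0) =
      a • (μ : Measure ℝ≥0).conv (ρ : Measure ℝ≥0) + b • (ν : Measure ℝ≥0).conv (ρ : Measure ℝ≥0)
    rw [Measure.add_conv]
    exact congrArg₂ (· + ·) (Measure.conv_smul_left _ _ _) (Measure.conv_smul_left _ _ _)
  homogeneous a _ μ ν :=
    Subtype.ext (Measure.map_conv_addMonoidHom (AddMonoidHom.mulLeft a)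
      (measurable_const_mul a)).symm
  continuous := continuous_classical
  exists_characteristicMeasure := ⟨_, isCharacteristicMeasure_classical_delta_one⟩

/-! ### Characteristic function and index of the classical convolution -/

lemma laplace_classical (μ ν : P) (t : ℝ≥0) :
    laplace (classical μ ν) t = laplace μ t * laplace ν t := by
  have h (x y : ℝ≥0) : expNeg t (x + y) = expNeg t x * expNeg t y := by
    simp only [expNeg_apply, ← Real.exp_add, NNReal.coe_add]
    ring_nf
  rw [laplace, coe_classical, integral_conv ((expNeg t).integrable _)]
  simp only [h, integral_const_mul, integral_mul_const, laplace]

lemma laplace_mix (a b : ℝ≥0) (hab : a + b = 1) (μ ν : P) (t : ℝ≥0) :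
    laplace (mix a b hab μ ν) t = a * laplace μ t + b * laplace ν t := by
  rw [laplace, coe_mix, integral_add_measure ((integrable_expNeg μ t).smul_measure_nnreal)
    ((integrable_expNeg ν t).smul_measure_nnreal), integral_smul_nnreal_measure,
    integral_smul_nnreal_measure]
  rfl

lemma laplace_scale (a : ℝ≥0) (μ : P) (t : ℝ≥0) :
    laplace (scale a μ) t = laplace μ (a * t) := by
  rw [laplace, coe_scale, integral_map (measurable_const_mul a).aemeasurable
    (expNeg t).continuous.aestronglyMeasurable, laplace]
  refine integral_congr_ae (.of_forall fun x => ?_)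
  simp only [expNeg_apply, NNReal.coe_mul]
  ring_nf

lemma laplace_delta (x t : ℝ≥0) : laplace (delta x) t = Real.exp (-((t : ℝ) * x)) := by
  rw [laplace, coe_delta, integral_dirac, expNeg_apply]

theorem isCharacteristicFunction_laplace : IsCharacteristicFunction classical laplace where
  injective := laplace_injective
  map_mix := laplace_mix
  map_op := laplace_classical
  map_scale a _ := laplace_scale a
  tendsto_iff := tendsto_iff_laplace

lemma isCharacteristicIndex_classical_one : IsCharacteristicIndex classical 1 :=
  ⟨one_pos, delta 1, isCharacteristicMeasure_classical_delta_one, laplace,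
    isCharacteristicFunction_laplace, fun t => by simp [laplace_delta]⟩

/-- With `x = c n * n`, pass to the limit in `δ_{2x} = δ_x * δ_x`, where doubling is a change of
scale. -/
lemma IsCharacteristicFunction.two_mul_eq_sq {Φ : P → ℝ≥0 → ℝ}
    (hΦ : IsCharacteristicFunction classical Φ) {σ : P} (hσ : IsCharacteristicMeasure classical σ)
    (t : ℝ≥0) : Φ σ (2 * t) = Φ σ t * Φ σ t := by
  obtain ⟨-, c, -, hc⟩ := hσ
  have hlim (s : ℝ≥0) := ((hΦ.tendsto_iff _ _).1 hc s).tendsto_at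
    (Set.right_mem_Icc.2 (zero_le (a := s)))
  refine tendsto_nhds_unique (hlim (2 * t)) (((hlim t).mul (hlim t)).congr fun n => ?_)
  rw [power_classical_delta_one, scale_delta, ← hΦ.map_op, classical_delta, ← two_mul,
    ← scale_delta 2, hΦ.map_scale 2 two_pos]

theorem isCharacteristicIndex_classical_iff (κ : ℝ) :
    IsCharacteristicIndex classical κ ↔ κ = 1 := by
  refine ⟨?_, fun h => h ▸ isCharacteristicIndex_classical_one⟩
  rintro ⟨-, σ, hσ, Φ, hΦ, h⟩
  have h2 := hΦ.two_mul_eq_sq hσ 1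
  rw [h, h, ← Real.exp_add, Real.exp_eq_exp] at h2
  simp only [NNReal.coe_ofNat, NNReal.coe_one, mul_one, Real.one_rpow] at h2
  have h3 : (2 : ℝ) ^ κ = 2 ^ (1 : ℝ) := by rw [Real.rpow_one]; linarith
  exact (Real.rpow_right_inj two_pos (by norm_num)).1 h3

/-! ### Moments -/

lemma moment_nonneg (μ : P) (n : ℕ) : 0 ≤ moment μ n :=
  integral_nonneg fun x => by positivity

lemma hasMoments_delta_zero : HasMoments (delta 0) := fun n =>
  integrable_dirac (by simp)

lemma moment_delta_zero (n : ℕ) : moment (delta 0) n = if n = 0 then 1 else 0 := by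
  rw [moment, coe_delta, integral_dirac]
  split_ifs with h <;> simp [h]

lemma HasMoments.integrable_add_pow {ν : P} (hν : HasMoments ν) (x : ℝ) (n : ℕ) :
    Integrable (fun y : ℝ≥0 => (x + (y : ℝ)) ^ n) (ν : Measure ℝ≥0) := by
  simp only [add_pow]
  exact integrable_finsetSum _ fun k _ => ((hν (n - k)).const_mul _).mul_const _

lemma HasMoments.integral_add_pow {ν : P} (hν : HasMoments ν) (x : ℝ) (n : ℕ) :
    ∫ y : ℝ≥0, (x + (y : ℝ)) ^ n ∂(ν : Measure ℝ≥0) =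
      ∑ k ∈ Finset.range (n + 1), x ^ k * moment ν (n - k) * n.choose k := by
  simp only [add_pow]
  rw [integral_finsetSum _ fun k _ => ((hν (n - k)).const_mul _).mul_const _]
  simp only [integral_mul_const, integral_const_mul, moment]

lemma HasMoments.classical {μ ν : P} (hμ : HasMoments μ) (hν : HasMoments ν) :
    HasMoments (classical μ ν) := fun n => by
  rw [coe_classical, integrable_conv_iff (by fun_prop)]
  refine ⟨.of_forall fun x => by simpa using hν.integrable_add_pow x n, ?_⟩
  have (x y : ℝ≥0) : ‖(((x + y : ℝ≥0) : ℝ)) ^ n‖ = ((x : ℝ) + y) ^ n := by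
    rw [Real.norm_eq_abs, abs_of_nonneg (by positivity), NNReal.coe_add]
  simp only [this, hν.integral_add_pow]
  exact integrable_finsetSum _ fun k _ => ((hμ k).mul_const _).mul_const _

lemma moment_classical {μ ν : P} (hμ : HasMoments μ) (hν : HasMoments ν) (n : ℕ) :
    moment (GenConv.classical μ ν) n =
      ∑ k ∈ Finset.range (n + 1), moment μ k * moment ν (n - k) * n.choose k := by
  have := hμ.classical hν n
  rw [coe_classical] at this
  rw [moment, coe_classical, integral_conv this]
  simp only [NNReal.coe_add, hν.integral_add_pow]
  rw [integral_finsetSum _ fun k _ => ((hμ k).mul_const _).mul_const _]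
  simp only [integral_mul_const, moment]

/-- The exponential generating function of the moments. -/
noncomputable def momentSeries (μ : P) : PowerSeries ℝ :=
  PowerSeries.mk fun n => moment μ n / n.factorial

lemma momentSeries_delta_zero : momentSeries (delta 0) = 1 := by
  ext n
  rw [momentSeries, PowerSeries.coeff_mk, moment_delta_zero, PowerSeries.coeff_one]
  split_ifs with h <;> simp [h]

lemma momentSeries_classical {μ ν : P} (hμ : HasMoments μ) (hν : HasMoments ν) :
    momentSeries (classical μ ν) = momentSeries μ * momentSeries ν := by
  ext n
  rw [PowerSeries.coeff_mul, Finset.Nat.sum_antidiagonal_eq_sum_range_succ_mk]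
  simp only [momentSeries, PowerSeries.coeff_mk, moment_classical hμ hν, Finset.sum_div]
  refine Finset.sum_congr rfl fun k hk => ?_
  rw [Nat.cast_choose ℝ (Nat.lt_succ_iff.1 (Finset.mem_range.1 hk))]
  have := Nat.factorial_ne_zero n
  field_simp

lemma power_classical_moments {μ : P} (hμ : HasMoments μ) (k : ℕ) :
    HasMoments (power classical μ k) ∧
      momentSeries (power classical μ k) = momentSeries μ ^ k := by
  induction k with
  | zero => exact ⟨hasMoments_delta_zero, momentSeries_delta_zero⟩
  | succ k ih => exact ⟨ih.1.classical hμ, by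
      rw [power, momentSeries_classical ih.1 hμ, ih.2, pow_succ]⟩

theorem isMultinomial_classical : IsMultinomial classical := by
  intro μ hμ k _
  obtain ⟨h1, h2⟩ := power_classical_moments hμ k
  refine ⟨h1, fun n => ?_⟩
  have h3 := congrArg (PowerSeries.coeff n) h2
  have h4 : momentSeries μ ^ k = ∏ _i : Fin k, momentSeries μ := by simp
  rw [h4, PowerSeries.coeff_prod] at h3
  simp only [momentSeries, PowerSeries.coeff_mk] at h3
  rw [div_eq_iff (by positivity), Finset.sum_mul] at h3
  rw [h3]
  -- `PowerSeries.coeff_prod` sums over finitely supported functions, the definition over plain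
  -- functions on `Fin k`.
  refine Finset.sum_bij' (fun l _ => ⇑l) (fun m _ => Finsupp.equivFunOnFinite.symm m)
    (fun l hl => ?_) (fun m hm => ?_) (fun l _ => ?_) (fun m _ => rfl) (fun l _ => ?_)
  · simpa using (Finset.mem_finsuppAntidiag.1 hl).1
  · simpa [Finset.mem_finsuppAntidiag] using hm
  · ext; rfl
  · rw [Finset.prod_div_distrib]
    ring

/-! ### Multinomial generalised convolutions -/

/-- The geometric bound dominates the norms by the series of `exp (t R)`, so the exponential series
may be integrated termwise. -/
lemma hasSum_laplace_of_moment_le {μ : P} (hμ : HasMoments μ) {R : ℝ}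
    (hR : ∀ n, moment μ n ≤ R ^ n) (t : ℝ≥0) :
    HasSum (fun n : ℕ => (-(t : ℝ)) ^ n / n.factorial * moment μ n) (laplace μ t) := by
  have hint (n : ℕ) : Integrable (fun x : ℝ≥0 => (-(t : ℝ)) ^ n / n.factorial * (x : ℝ) ^ n)
      (μ : Measure ℝ≥0) := (hμ n).const_mul _
  have hnorm (n : ℕ) :
      ∫ x : ℝ≥0, ‖(-(t : ℝ)) ^ n / n.factorial * (x : ℝ) ^ n‖ ∂(μ : Measure ℝ≥0) =
        (t : ℝ) ^ n / n.factorial * moment μ n := by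
    rw [moment, ← integral_const_mul]
    refine integral_congr_ae (.of_forall fun x => ?_)
    simp
  have hsum : Summable fun n : ℕ =>
      ∫ x : ℝ≥0, ‖(-(t : ℝ)) ^ n / n.factorial * (x : ℝ) ^ n‖ ∂(μ : Measure ℝ≥0) := by
    simp only [hnorm]
    refine Summable.of_nonneg_of_le (fun n => mul_nonneg (by positivity) (moment_nonneg μ n))
      (fun n => ?_) (Real.summable_pow_div_factorial (t * R))
    rw [mul_pow, mul_div_right_comm]
    exact mul_le_mul_of_nonneg_left (hR n) (by positivity)
  have h := hasSum_integral_of_summable_integral_norm hint hsum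
  simp only [integral_const_mul] at h
  convert! h using 1
  refine integral_congr_ae (.of_forall fun x => ?_)
  have h1 := (NormedSpace.expSeries_div_hasSum_exp (𝔸 := ℝ) (-((t : ℝ) * x))).tsum_eq
  rw [← Real.exp_eq_exp_ℝ] at h1
  simp only [expNeg_apply]
  rw [← h1]
  refine tsum_congr fun n => ?_
  rw [neg_mul_eq_neg_mul, mul_pow]
  ring

lemma eq_of_moment_eq {μ ν : P} (hμ : HasMoments μ) (hν : HasMoments ν) {R : ℝ}
    (hR : ∀ n, moment μ n ≤ R ^ n) (h : ∀ n, moment ν n = moment μ n) : μ = ν := by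
  refine laplace_injective (funext fun t => (hasSum_laplace_of_moment_le hμ hR t).unique ?_)
  simpa only [h] using hasSum_laplace_of_moment_le hν (fun n => (h n).le.trans (hR n)) t

/-- The measure `μ` is carried by a bounded interval. -/
def IsBounded (μ : P) : Prop := ∃ R : ℝ≥0, ∀ᵐ x ∂(μ : Measure ℝ≥0), x ≤ R

lemma IsBounded.hasMoments {μ : P} (h : IsBounded μ) : HasMoments μ := fun n => by
  obtain ⟨R, hR⟩ := h
  refine Integrable.of_bound (by fun_prop) ((R : ℝ) ^ n) ?_
  filter_upwards [hR] with x hx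
  rw [Real.norm_eq_abs, abs_of_nonneg (by positivity)]
  gcongr

lemma IsBounded.exists_moment_le {μ : P} (h : IsBounded μ) :
    ∃ R : ℝ, 0 ≤ R ∧ ∀ n, moment μ n ≤ R ^ n := by
  have hm := h.hasMoments
  obtain ⟨R, hR⟩ := h
  refine ⟨R, R.2, fun n => ?_⟩
  have : ∫ _x : ℝ≥0, (R : ℝ) ^ n ∂(μ : Measure ℝ≥0) = (R : ℝ) ^ n := by simp
  rw [← this]
  refine integral_mono_ae (hm n) (integrable_const _) ?_
  filter_upwards [hR] with x hx
  gcongr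

lemma IsBounded.mix {μ ν : P} (hμ : IsBounded μ) (hν : IsBounded ν) (a b : ℝ≥0)
    (hab : a + b = 1) : IsBounded (mix a b hab μ ν) := by
  obtain ⟨R, hR⟩ := hμ
  obtain ⟨S, hS⟩ := hν
  refine ⟨max R S, ?_⟩
  rw [coe_mix, ae_add_measure_iff]
  exact ⟨Measure.ae_smul_measure (hR.mono fun x hx => hx.trans (le_max_left _ _)) a,
    Measure.ae_smul_measure (hS.mono fun x hx => hx.trans (le_max_right _ _)) b⟩

lemma IsMultinomial.op_self {op : P → P → P} (hop : IsGeneralizedConvolution op)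
    (hm : IsMultinomial op) {μ : P} (hμ : IsBounded μ) : op μ μ = classical μ μ := by
  have h1 : power op μ 2 = op μ μ := by simp only [power, hop.unit]
  have h2 : power classical μ 2 = classical μ μ := by simp only [power, classical_delta_zero]
  obtain ⟨h3, h4⟩ := hm μ hμ.hasMoments 2 one_le_two
  obtain ⟨h5, h6⟩ := isMultinomial_classical μ hμ.hasMoments 2 one_le_two
  rw [h1] at h3 h4
  rw [h2] at h5 h6
  obtain ⟨R, hR0, hR⟩ := hμ.exists_moment_le
  -- The bound `(R + R) ^ n` is the binomial expansion with each moment replaced by its bound.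
  refine (eq_of_moment_eq h5 h3 (R := R + R) (fun n => ?_) fun n => by rw [h4, h6]).symm
  rw [moment_classical hμ.hasMoments hμ.hasMoments, add_pow]
  refine Finset.sum_le_sum fun k _ => ?_
  have := hR k
  have := hR (n - k)
  have := moment_nonneg μ (n - k)
  gcongr

lemma IsMultinomial.op_of_isBounded {op : P → P → P} (hop : IsGeneralizedConvolution op)
    (hm : IsMultinomial op) {μ ν : P} (hμ : IsBounded μ) (hν : IsBounded ν) :
    op μ ν = classical μ ν := by
  have hab : (1 / 2 : ℝ≥0) + 1 / 2 = 1 := by norm_num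
  -- Polarisation: the square of the midpoint mixture expresses the cross term through squares, and
  -- all three mixtures squared are bounded.
  have expand {o : P → P → P} (ho : IsGeneralizedConvolution o) (t : ℝ≥0) :
      laplace (o (mix _ _ hab μ ν) (mix _ _ hab μ ν)) t =
        (laplace (o μ μ) t + 2 * laplace (o μ ν) t + laplace (o ν ν) t) / 4 := by
    rw [ho.distrib, laplace_mix, ho.comm μ, ho.comm ν, ho.distrib, ho.distrib, laplace_mix,
      laplace_mix, ho.comm ν μ]
    push_cast
    ring
  refine laplace_injective (funext fun t => ?_)
  have h1 := expand hop t
  have h2 := expand isGeneralizedConvolution_classical t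
  rw [hm.op_self hop (hμ.mix hν _ _ hab), hm.op_self hop hμ, hm.op_self hop hν, h2] at h1
  linarith

/-! ### Passage from bounded to arbitrary measures -/

/-- The law of `min X R` when `X` has law `μ`. -/
noncomputable def truncate (R : ℝ≥0) (μ : P) : P :=
  μ.map (f := fun x : ℝ≥0 => min x R) (by fun_prop)

lemma isBounded_truncate (R : ℝ≥0) (μ : P) : IsBounded (truncate R μ) := by
  refine ⟨R, ?_⟩
  rw [truncate, ProbabilityMeasure.toMeasure_map, ae_map_iff (by fun_prop) measurableSet_Iic]
  exact .of_forall fun x => min_le_right _ _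

lemma tendsto_truncate (μ : P) :
    Tendsto (fun n : ℕ => truncate n μ) atTop (𝓝 μ) := by
  rw [ProbabilityMeasure.tendsto_iff_forall_integral_tendsto]
  intro f
  have (n : ℕ) : ∫ x, f x ∂(truncate n μ : Measure ℝ≥0) =
      ∫ x, f (min x n) ∂(μ : Measure ℝ≥0) := by
    rw [truncate, ProbabilityMeasure.toMeasure_map, integral_map (by fun_prop)
      f.continuous.aestronglyMeasurable]
  simp only [this]
  refine tendsto_integral_of_dominated_convergence (fun _ => ‖f‖)
    (fun n => (f.continuous.comp (by fun_prop)).aestronglyMeasurable) (integrable_const _)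
    (fun n => .of_forall fun x => f.norm_coe_le_norm _) (.of_forall fun x => ?_)
  refine tendsto_const_nhds.congr' ?_
  filter_upwards [tendsto_natCast_atTop_atTop.eventually_ge_atTop x] with n hn
  rw [min_eq_left hn]

theorem IsMultinomial.eq_classical {op : P → P → P} (hop : IsGeneralizedConvolution op)
    (hm : IsMultinomial op) : op = classical := by
  -- Continuity is given only in the first variable, so this is used twice, with commutativity
  -- exchanging the variables.
  have extend {ν : P} (h : ∀ μ, IsBounded μ → op μ ν = classical μ ν) (μ : P) :
      op μ ν = classical μ ν := by
    refine tendsto_nhds_unique (((hop.continuous ν).tendsto μ).comp (tendsto_truncate μ)) ?_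
    refine (((continuous_classical ν).tendsto μ).comp (tendsto_truncate μ)).congr fun n => ?_
    exact (h _ (isBounded_truncate _ _)).symm
  funext μ ν
  refine extend (fun μ hμ => ?_) μ
  rw [hop.comm, classical_comm]
  exact extend (fun ν hν => hm.op_of_isBounded hop hν hμ) ν

end GenConv

theorem mainTheorem12 :
    (GenConv.IsGeneralizedConvolution GenConv.classical ∧
      GenConv.IsMultinomial GenConv.classical ∧
      ∀ κ : ℝ, GenConv.IsCharacteristicIndex GenConv.classical κ ↔ κ = 1) ∧
    ∀ op : GenConv.P → GenConv.P → GenConv.P,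
      GenConv.IsGeneralizedConvolution op → op ≠ GenConv.classical →
        ¬ GenConv.IsMultinomial op :=
  ⟨⟨GenConv.isGeneralizedConvolution_classical, GenConv.isMultinomial_classical,
    GenConv.isCharacteristicIndex_classical_iff⟩,
    fun _ hop hne hm => hne (hm.eq_classical hop)⟩
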